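/- All graphs are finite and simple. Two distinct vertices of a graph $G$ are \emph{twins} if they have the same open neighborhood. A \emph{minimum twin cover} of $G$ is a set of vertices of minimum size that contains at least one vertex of every pair of twins. $\widetilde G$ denotes the quotient graph whose vertices are the classes of vertices with equal open neighborhood, two classes being adjacent if and only if they contain adjacent representatives. A set $S\subseteq V(G)$ is \emph{determining} if the identity is the only automorphism of $G$ that fixes every element of $S$, and $\det(G)$ is the minimum size of a determining set. For $t\ge 1$ and $V(G)=\{v_1,\dots,v_n\}$, the generalized Mycielskian $\mu^{(t)}(G)$ has vertices $u_i^s$ ($1\le i\le n$, $0\le s\le t$) and $w$, and its edges are $u_i^0u_j^0$, $u_i^su_j^{s+1}$ and $u_j^su_i^{s+1}$ ($0\le s<t$) for every edge $v_iv_j$ of $G$, together with $u_i^tw$ for all $i$. \textbf{Theorem.} Let $t\ge 1$. (a) Let $G$ be a graph with no isolated vertices that has at least one pair of twins, and let $T$ be a minimum twin cover of $G$. Then \[(t+1)|T|\ \le\ \det(\mu^{(t)}(G))\ \le\ (t+1)|T|+\det(\widetilde G).\] (b) Both bounds are sharp, with $\det(\widetilde G)=1$ in each of the following families of graphs satisfying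 the hypotheses of (a). The lower bound is attained by every complete bipartite graph $K_{\ell,m}$ with $\ell\ge 1$, $m\ge 2$: it has a minimum twin cover $T$ with $|T|=\ell+m-2$, and $\det(\mu^{(t)}(K_{\ell,m}))=(t+1)|T|$. The upper bound is attained, for every $n\ge 2$, by the graph with vertices $u,v,w,z,x_1,\dots,x_n$ and edges $uv$, $wz$, $vx_i$, $wx_i$ ($1\le i\le n$), which for $n=2$ is a $4$-cycle with pendant vertices at two opposite vertices: it has a minimum twin cover $T$ with $|T|=n-1$, and $\det(\mu^{(t)}(G))=(t+1)|T|+\det(\widetilde G)$. -/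

import Mathlib

namespace SimpleGraph

/-- `S` is a determining set of `G`: only the trivial automorphism fixes `S` pointwise. -/
def IsDetermining {V : Type*} (G : SimpleGraph V) (S : Finset V) : Prop :=
  ∀ φ : G ≃g G, (∀ x ∈ S, φ x = x) → φ = Iso.refl

/-- The determining number: the least size of a determining set (for a finite graph the whole
vertex set is determining, so the minimum exists). -/
noncomputable def detNumber {V : Type*} (G : SimpleGraph V) : ℕ :=
  sInf {k : ℕ | ∃ S : Finset V, G.IsDetermining S ∧ S.card = k}

/-- The relation of having the same open neighborhood. -/
def twinSetoid {V : Type*} (G : SimpleGraph V) : Setoid V where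
  r x y := G.neighborSet x = G.neighborSet y
  iseqv := ⟨fun _ => rfl, fun h => h.symm, fun h₁ h₂ => h₁.trans h₂⟩

/-- Two distinct vertices are twins if they have the same open neighborhood. -/
def IsTwin {V : Type*} (G : SimpleGraph V) (x y : V) : Prop :=
  x ≠ y ∧ G.neighborSet x = G.neighborSet y

/-- `T` contains at least one vertex of every pair of twins. -/
def IsTwinCover {V : Type*} (G : SimpleGraph V) (T : Finset V) : Prop :=
  ∀ x y : V, G.IsTwin x y → x ∈ T ∨ y ∈ T

/-- A twin cover of minimum size. -/
def IsMinTwinCover {V : Type*} (G : SimpleGraph V) (T : Finset V) : Prop :=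
  G.IsTwinCover T ∧ ∀ T' : Finset V, G.IsTwinCover T' → T.card ≤ T'.card

/-- The quotient graph `G̃` on the classes of vertices with the same open neighborhood; two
classes are adjacent iff they have adjacent representatives. -/
def twinQuotient {V : Type*} (G : SimpleGraph V) : SimpleGraph (Quotient G.twinSetoid) where
  Adj a b := ∃ p q : V, Quotient.mk _ p = a ∧ Quotient.mk _ q = b ∧ G.Adj p q
  symm := ⟨fun _ _ ⟨p, q, hp, hq, h⟩ => ⟨q, p, hq, hp, h.symm⟩⟩
  loopless := ⟨by
    rintro a ⟨p, q, hp, hq, h⟩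
    have hpq : G.neighborSet p = G.neighborSet q := Quotient.exact (hp.trans hq.symm)
    have hq' : q ∈ G.neighborSet q := hpq ▸ h
    exact G.irrefl hq'⟩

/-- Adjacency of the generalized Mycielskian: `some (s, x)` is the copy of `x` at level `s`
(level `0` carries the original vertices), `none` is the shadow master. -/
def genMycielskianAdj {V : Type*} (G : SimpleGraph V) (t : ℕ) :
    Option (Fin (t + 1) × V) → Option (Fin (t + 1) × V) → Prop
  | some (s, x), some (r, y) =>
      G.Adj x y ∧ (((s : ℕ) = 0 ∧ (r : ℕ) = 0) ∨ (r : ℕ) = s + 1 ∨ (s : ℕ) = r + 1)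
  | some (s, _), none => (s : ℕ) = t
  | none, some (r, _) => (r : ℕ) = t
  | none, none => False

/-- The generalized Mycielskian `μ^(t)(G)` with `t` levels of shadow vertices. -/
def genMycielskian {V : Type*} (G : SimpleGraph V) (t : ℕ) :
    SimpleGraph (Option (Fin (t + 1) × V)) where
  Adj := G.genMycielskianAdj t
  symm := ⟨by
    rintro (_ | ⟨s, x⟩) (_ | ⟨r, y⟩) h
    · exact h
    · exact h
    · exact h
    · exact ⟨h.1.symm, by have := h.2; omega⟩⟩
  loopless := ⟨by
    rintro (_ | ⟨s, x⟩) h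
    · exact h
    · exact G.irrefl h.1⟩

/-- The 4-cycle with two pendant vertices, with the middle vertex multiplied: vertices
`u, v, w, z` (`Sum.inl 0, 1, 2, 3`) and `x_1, …, x_n` (`Sum.inr i`), with the edges
`uv`, `wz` and `v x_i`, `w x_i` for all `i`. -/
def pendantC4 (n : ℕ) : SimpleGraph (Fin 4 ⊕ Fin n) :=
  fromRel fun a b => match a, b with
    | Sum.inl a, Sum.inl b => (a = 0 ∧ b = 1) ∨ (a = 2 ∧ b = 3)
    | Sum.inl a, Sum.inr _ => a = 1 ∨ a = 2
    | _, _ => False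

end SimpleGraph

/-!
The level of a vertex of `μ^(t)(G)` is `t + 1` minus its distance to the shadow master `w`, so an
automorphism that fixes `w` permutes each level. Level `0` carries an automorphism `g` of `G`, and,
climbing one level at a time, the permutation of every other level agrees with `g` up to twins.
Hence a set whose traces on all levels are twin covers and whose trace on level `0` is determining
for `G` is determining for `μ^(t)(G)`, as soon as it forces `w` to be fixed. Conversely every
determining set has to meet each level in a twin cover, because twins of `G` give twins at every
level.

Both sharpness families are blow-ups of twin-free paths: the complete bipartite graphs of `P₂`, the
4-cycles with two pendant vertices of `P₅`.
-/

namespace DeterminingNumber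

open SimpleGraph Function

section Determining

variable {V W : Type*} {G : SimpleGraph V} {H : SimpleGraph W} {S : Finset V}

theorem detNumber_le_card (hS : G.IsDetermining S) : G.detNumber ≤ S.card :=
  Nat.sInf_le ⟨S, hS, rfl⟩

theorem isDetermining_of_card_le [Finite V] (hS : Nat.card V ≤ S.card + 1) :
    G.IsDetermining S := by
  classical
  have := Fintype.ofFinite V
  intro φ hφ
  ext x
  by_contra! hne
  have hx : x ∉ S := fun h => hne (hφ x h)
  have hφx : φ x ∉ insert x S := by
    rw [Finset.mem_insert, not_or]
    exact ⟨hne, fun h => hne (φ.injective (hφ _ h))⟩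
  have hcard := (insert (φ x) (insert x S)).card_le_univ
  rw [Finset.card_insert_of_notMem hφx, Finset.card_insert_of_notMem hx,
    ← Nat.card_eq_fintype_card] at hcard
  omega

theorem exists_isDetermining_card_eq_detNumber [Finite V] (G : SimpleGraph V) :
    ∃ S : Finset V, G.IsDetermining S ∧ S.card = G.detNumber := by
  have := Fintype.ofFinite V
  exact Nat.sInf_mem (s := {k | ∃ S : Finset V, G.IsDetermining S ∧ S.card = k})
    ⟨_, Finset.univ, isDetermining_of_card_le (by simp), rfl⟩

theorem le_detNumber [Finite V] {k : ℕ} (h : ∀ S : Finset V, G.IsDetermining S → k ≤ S.card) :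
    k ≤ G.detNumber := by
  obtain ⟨S, hS, hcard⟩ := exists_isDetermining_card_eq_detNumber G
  exact hcard ▸ h S hS

theorem exists_isDetermining_of_iso (e : G ≃g H) (hS : G.IsDetermining S) :
    ∃ S' : Finset W, H.IsDetermining S' ∧ S'.card = S.card := by
  refine ⟨S.map e.toEquiv.toEmbedding, fun φ hφ => ?_, S.card_map _⟩
  have hconj : (e.trans φ).trans e.symm = Iso.refl := hS _ fun x hx =>
    e.injective (by simpa using hφ _ (Finset.mem_map_of_mem e.toEquiv.toEmbedding hx))
  ext y
  simpa using congrArg e (DFunLike.congr_fun hconj (e.symm y))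

theorem detNumber_congr (e : G ≃g H) : G.detNumber = H.detNumber := by
  refine congrArg sInf (Set.ext fun k => ⟨?_, ?_⟩)
  · rintro ⟨S, hS, rfl⟩
    exact exists_isDetermining_of_iso e hS
  · rintro ⟨S, hS, rfl⟩
    exact exists_isDetermining_of_iso e.symm hS

theorem detNumber_eq_one [Finite V] {x : V} (hx : G.IsDetermining {x}) {φ : G ≃g G}
    (hφ : φ ≠ Iso.refl) : G.detNumber = 1 := by
  refine le_antisymm (detNumber_le_card hx) (le_detNumber fun S hS => Finset.card_pos.2 ?_)
  rw [Finset.nonempty_iff_ne_empty]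
  rintro rfl
  exact hφ (hS φ (by simp))

end Determining

section Twins

variable {V W : Type*} {G : SimpleGraph V} {H : SimpleGraph W} {S T : Finset V} {x y z : V}

theorem adj_congr_of_neighborSet_eq (h : G.neighborSet x = G.neighborSet y) :
    G.Adj x z ↔ G.Adj y z :=
  Set.ext_iff.1 h z

theorem isTwinCover_iff_injOn : G.IsTwinCover T ↔ Set.InjOn G.neighborSet (↑T)ᶜ := by
  simp only [IsTwinCover, IsTwin, Set.InjOn, Set.mem_compl_iff, Finset.mem_coe]
  grind

/-- The automorphism that interchanges two vertices with the same open neighborhood. -/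
def twinSwap [DecidableEq V] (h : G.neighborSet x = G.neighborSet y) : G ≃g G where
  toEquiv := Equiv.swap x y
  map_rel_iff' {a b} := by
    have swap_adj (a b : V) : G.Adj (Equiv.swap x y a) b ↔ G.Adj a b := by
      rw [Equiv.swap_apply_def]
      split_ifs with ha ha
      · rw [ha, adj_congr_of_neighborSet_eq h]
      · rw [ha, adj_congr_of_neighborSet_eq h]
      · rfl
    rw [swap_adj, G.adj_comm, swap_adj, G.adj_comm]

theorem isTwinCover_of_isDetermining (hS : G.IsDetermining S) : G.IsTwinCover S := by
  classical
  rintro x y ⟨hne, h⟩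
  by_contra! hxy
  have hid : twinSwap h = Iso.refl := hS _ fun z hz =>
    Equiv.swap_apply_of_ne_of_ne (ne_of_mem_of_not_mem hz hxy.1) (ne_of_mem_of_not_mem hz hxy.2)
  exact hne ((Equiv.swap_apply_left x y).symm.trans (DFunLike.congr_fun hid x)).symm

theorem apply_eq_self_of_isTwinCover (hT : G.IsTwinCover T) {f : V → V} (hf : Injective f)
    (hfix : ∀ x ∈ T, f x = x) (htwin : ∀ x, G.neighborSet (f x) = G.neighborSet x) (x : V) :
    f x = x := by
  by_contra hne
  rcases hT (f x) x ⟨hne, htwin x⟩ with h | h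
  · exact hne (hf (hfix _ h))
  · exact hne (hfix x h)

theorem neighborSet_apply_eq_iff (φ : G ≃g H) :
    H.neighborSet (φ x) = H.neighborSet (φ y) ↔ G.neighborSet x = G.neighborSet y := by
  simp only [Set.ext_iff, mem_neighborSet, φ.surjective.forall, φ.map_adj_iff]

theorem twinQuotient_adj_mk :
    G.twinQuotient.Adj (Quotient.mk _ x) (Quotient.mk _ y) ↔ G.Adj x y := by
  refine ⟨?_, fun h => ⟨x, y, rfl, rfl, h⟩⟩
  rintro ⟨p, q, hp, hq, h⟩
  rwa [← adj_congr_of_neighborSet_eq (Quotient.exact hp), G.adj_comm,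
    ← adj_congr_of_neighborSet_eq (Quotient.exact hq), G.adj_comm]

/-- The isomorphism of twin quotients induced by an isomorphism of graphs. -/
def twinQuotientIso (φ : G ≃g H) : G.twinQuotient ≃g H.twinQuotient where
  toEquiv := Quotient.congr φ.toEquiv fun _ _ => (neighborSet_apply_eq_iff φ).symm
  map_rel_iff' := by
    rintro ⟨x⟩ ⟨y⟩
    exact twinQuotient_adj_mk.trans (φ.map_adj_iff.trans twinQuotient_adj_mk.symm)

theorem isDetermining_of_twinQuotient (hS : G.IsTwinCover S)
    {D : Finset (Quotient G.twinSetoid)} (hD : G.twinQuotient.IsDetermining D)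
    (hDS : ∀ d ∈ D, ∃ x ∈ S, Quotient.mk _ x = d) : G.IsDetermining S := by
  intro φ hφ
  have hid : twinQuotientIso φ = Iso.refl := hD _ fun d hd => by
    obtain ⟨x, hx, rfl⟩ := hDS d hd
    exact congrArg (Quotient.mk _) (hφ x hx)
  ext x
  exact apply_eq_self_of_isTwinCover hS φ.injective hφ
    (fun y => Quotient.exact (DFunLike.congr_fun hid (Quotient.mk _ y))) x

theorem card_le_card_add_of_isTwinCover [Finite V] (hT : G.IsTwinCover T) :
    Nat.card V ≤ T.card + Nat.card (Quotient G.twinSetoid) := by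
  classical
  have := Fintype.ofFinite V
  rw [Nat.card_eq_fintype_card, Nat.card_eq_fintype_card, ← T.card_add_card_compl]
  refine Nat.add_le_add_left (Finset.card_le_card_of_injOn (Quotient.mk G.twinSetoid)
    (fun _ _ => Finset.mem_univ _) ?_) _
  rw [Finset.coe_compl]
  exact fun x hx y hy h => isTwinCover_iff_injOn.1 hT hx hy (Quotient.exact h)

theorem exists_isMinTwinCover [Finite V] (G : SimpleGraph V) :
    ∃ T, G.IsMinTwinCover T ∧ T.card + Nat.card (Quotient G.twinSetoid) = Nat.card V := by
  classical
  have := Fintype.ofFinite V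
  let R : Finset V := Finset.univ.map ⟨Quotient.out (s := G.twinSetoid), Quotient.out_injective⟩
  have hcard : Rᶜ.card + Nat.card (Quotient G.twinSetoid) = Nat.card V := by
    rw [Nat.card_eq_fintype_card, Nat.card_eq_fintype_card, ← R.card_compl_add_card,
      Finset.card_map, Finset.card_univ]
  refine ⟨Rᶜ, ⟨isTwinCover_iff_injOn.2 ?_, fun T hT => ?_⟩, hcard⟩
  · have hR : (↑R : Set V) = Set.range (Quotient.out (s := G.twinSetoid)) := by simp [R]
    rw [Finset.coe_compl, compl_compl, hR]
    rintro _ ⟨a, rfl⟩ _ ⟨b, rfl⟩ h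
    have hab : a = b := a.out_eq.symm.trans ((Quotient.sound h).trans b.out_eq)
    rw [hab]
  · have := card_le_card_add_of_isTwinCover hT
    omega

end Twins

section BlowUp

variable {V W : Type*} {H : SimpleGraph W} {f : V → W}

theorem not_isIsolated_comap (hf : Surjective f) (hH : ∀ a, ¬ H.IsIsolated a) (x : V) :
    ¬ (H.comap f).IsIsolated x :=
  fun hx => hH (f x) (hf.forall.2 hx)

theorem neighborSet_comap_eq_iff (hf : Surjective f) (hH : Injective H.neighborSet) {x y : V} :
    (H.comap f).neighborSet x = (H.comap f).neighborSet y ↔ f x = f y :=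
  hf.preimage_injective.eq_iff.trans hH.eq_iff

/-- Blowing up the vertices of a twin-free graph and then identifying twins gives the graph back. -/
noncomputable def twinQuotientComapIso (hf : Surjective f) (hH : Injective H.neighborSet) :
    (H.comap f).twinQuotient ≃g H where
  toEquiv := (Quotient.congrRight fun _ _ => neighborSet_comap_eq_iff hf hH).trans
    (Setoid.quotientKerEquivOfSurjective f hf)
  map_rel_iff' := by
    rintro ⟨x⟩ ⟨y⟩
    exact (twinQuotient_adj_mk (G := H.comap f)).symm

end BlowUp

section Mycielskian

variable {V W : Type*} {G : SimpleGraph V} {H : SimpleGraph W} {t : ℕ}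

theorem genMycielskian_adj_some {s r : Fin (t + 1)} {x y : V} :
    (G.genMycielskian t).Adj (some (s, x)) (some (r, y)) ↔
      G.Adj x y ∧ (((s : ℕ) = 0 ∧ (r : ℕ) = 0) ∨ (r : ℕ) = s + 1 ∨ (s : ℕ) = r + 1) :=
  Iff.rfl

theorem genMycielskian_adj_none {r : Fin (t + 1)} {y : V} :
    (G.genMycielskian t).Adj none (some (r, y)) ↔ (r : ℕ) = t :=
  Iff.rfl

/-- The isomorphism of generalized Mycielskians induced by an isomorphism of graphs. -/
def genMycielskianIso (t : ℕ) (g : G ≃g H) : G.genMycielskian t ≃g H.genMycielskian t where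
  toEquiv := Equiv.optionCongr ((Equiv.refl _).prodCongr g.toEquiv)
  map_rel_iff' := by
    rintro (_ | ⟨s, x⟩) (_ | ⟨r, y⟩)
    · exact Iff.rfl
    · exact Iff.rfl
    · exact Iff.rfl
    · exact and_congr_left fun _ => g.map_adj_iff

section LevelFiber

variable {S : Finset (Option (Fin (t + 1) × V))} {T : Finset V}

/-- The trace of `S` on level `s` of the generalized Mycielskian, as a set of vertices of `G`. -/
noncomputable def levelFiber (S : Finset (Option (Fin (t + 1) × V))) (s : Fin (t + 1)) : Finset V :=
  S.preimage (fun x => some (s, x)) fun x _ y _ h => by simpa using h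

/-- The set of vertices of the generalized Mycielskian whose trace on level `s` is `F s`, without
the shadow master. -/
def levelUnion (F : Fin (t + 1) → Finset V) : Finset (Option (Fin (t + 1) × V)) :=
  (Finset.univ.sigma F).map ((Equiv.sigmaEquivProd _ _).toEmbedding.trans Embedding.some)

theorem mem_levelFiber {s : Fin (t + 1)} {x : V} : x ∈ levelFiber S s ↔ some (s, x) ∈ S :=
  Finset.mem_preimage

theorem some_mem_levelUnion {F : Fin (t + 1) → Finset V} {s : Fin (t + 1)} {x : V} :
    some (s, x) ∈ levelUnion F ↔ x ∈ F s := by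
  simp [levelUnion]

theorem none_notMem_levelUnion {F : Fin (t + 1) → Finset V} : none ∉ levelUnion F := by
  simp [levelUnion]

theorem levelFiber_levelUnion (F : Fin (t + 1) → Finset V) (s : Fin (t + 1)) :
    levelFiber (levelUnion F) s = F s := by
  ext x
  rw [mem_levelFiber, some_mem_levelUnion]

theorem card_levelUnion (F : Fin (t + 1) → Finset V) : (levelUnion F).card = ∑ s, (F s).card := by
  rw [levelUnion, Finset.card_map, Finset.card_sigma]

theorem sum_card_levelFiber_le : ∑ s, (levelFiber S s).card ≤ S.card := by
  rw [← card_levelUnion]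
  refine Finset.card_le_card ?_
  rintro (_ | ⟨s, x⟩) h
  · exact absurd h none_notMem_levelUnion
  · exact mem_levelFiber.1 (some_mem_levelUnion.1 h)

theorem mul_card_le_of_isTwinCover_levelFiber (hT : G.IsMinTwinCover T)
    (hS : ∀ s, G.IsTwinCover (levelFiber S s)) : (t + 1) * T.card ≤ S.card := by
  calc (t + 1) * T.card = ∑ _s : Fin (t + 1), T.card := by simp
    _ ≤ ∑ s, (levelFiber S s).card := Finset.sum_le_sum fun s _ => hT.2 _ (hS s)
    _ ≤ S.card := sum_card_levelFiber_le

end LevelFiber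

section LowerBound

variable {S : Finset (Option (Fin (t + 1) × V))} {T : Finset V}

theorem isTwin_genMycielskian {x y : V} (h : G.IsTwin x y) (s : Fin (t + 1)) :
    (G.genMycielskian t).IsTwin (some (s, x)) (some (s, y)) := by
  refine ⟨fun e => h.1 (by simpa using e), ?_⟩
  ext (_ | ⟨r, z⟩)
  · exact Iff.rfl
  · simp only [mem_neighborSet, genMycielskian_adj_some, adj_congr_of_neighborSet_eq h.2]

theorem isTwinCover_levelFiber (hS : (G.genMycielskian t).IsTwinCover S) (s : Fin (t + 1)) :
    G.IsTwinCover (levelFiber S s) := fun x y h => by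
  simpa only [mem_levelFiber] using hS _ _ (isTwin_genMycielskian h s)

theorem mul_card_le_detNumber_genMycielskian [Finite V] (hT : G.IsMinTwinCover T) :
    (t + 1) * T.card ≤ (G.genMycielskian t).detNumber :=
  le_detNumber fun _ hS => mul_card_le_of_isTwinCover_levelFiber hT
    (isTwinCover_levelFiber (isTwinCover_of_isDetermining hS))

theorem exists_mem_apply_ne_of_isDetermining (hS : (G.genMycielskian t).IsDetermining S)
    {g : G ≃g G} (hg : g ≠ Iso.refl) : ∃ s x, some (s, x) ∈ S ∧ g x ≠ x := by
  by_contra! hfix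
  have hid : genMycielskianIso t g = Iso.refl := hS _ fun v hv => by
    rcases v with _ | ⟨s, x⟩
    · rfl
    · exact congrArg (fun y => some (s, y)) (hfix s x hv)
  refine hg (RelIso.ext fun x => ?_)
  have : some ((0 : Fin (t + 1)), g x) = some (0, x) := DFunLike.congr_fun hid (some (0, x))
  simpa using this

/-- The vertex moved by `g` that a determining set must contain has no twins, so it can be removed
without spoiling any of the twin covers. -/
theorem mul_card_add_one_le_detNumber_genMycielskian [Finite V] (hT : G.IsMinTwinCover T)
    {g : G ≃g G} (hg : g ≠ Iso.refl) (hfix : ∀ x y, G.IsTwin x y → g x = x) :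
    (t + 1) * T.card + 1 ≤ (G.genMycielskian t).detNumber := by
  classical
  refine le_detNumber fun S hS => ?_
  obtain ⟨s, z, hz, hgz⟩ := exists_mem_apply_ne_of_isDetermining hS hg
  rw [← Finset.card_erase_add_one hz, Nat.add_le_add_iff_right]
  refine mul_card_le_of_isTwinCover_levelFiber hT fun r x y h => ?_
  have mem_erase {x : V} (hx : x ∈ levelFiber S r) (hgx : g x = x) :
      x ∈ levelFiber (S.erase (some (s, z))) r := by
    rw [mem_levelFiber] at hx ⊢
    refine Finset.mem_erase.2 ⟨fun e => hgz ?_, hx⟩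
    simp only [Option.some.injEq, Prod.mk.injEq] at e
    rw [← e.2, hgx]
  exact (isTwinCover_levelFiber (isTwinCover_of_isDetermining hS) r x y h).imp
    (mem_erase · (hfix x y h)) (mem_erase · (hfix y x ⟨h.1.symm, h.2.symm⟩))

end LowerBound

section Level

/-- The level of a vertex of the generalized Mycielskian, the shadow master being on level
`t + 1`. -/
def level (v : Option (Fin (t + 1) × V)) : ℕ :=
  v.elim (t + 1) fun p => p.1

theorem level_le_succ_of_adj {v w : Option (Fin (t + 1) × V)}
    (h : (G.genMycielskian t).Adj v w) : level w ≤ level v + 1 := by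
  rcases v with _ | ⟨s, x⟩ <;> rcases w with _ | ⟨r, y⟩
  · exact Nat.le_succ _
  · exact r.2.le.trans (Nat.le_succ _)
  · exact Nat.succ_le_succ (Eq.ge h)
  · have := h.2
    change (r : ℕ) ≤ s + 1
    omega

theorem level_le_add_length {v w : Option (Fin (t + 1) × V)}
    (p : (G.genMycielskian t).Walk v w) : level w ≤ level v + p.length := by
  induction p with
  | nil => exact le_rfl
  | cons h p ih =>
    have := level_le_succ_of_adj h
    rw [Walk.length_cons]
    omega

theorem exists_walk_none (hG : ∀ x, ¬ G.IsIsolated x) (v : Option (Fin (t + 1) × V)) :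
    ∃ p : (G.genMycielskian t).Walk v none, level v + p.length = t + 1 := by
  rcases v with _ | ⟨s, x⟩
  · exact ⟨Walk.nil, rfl⟩
  · induction s using Fin.reverseInduction generalizing x with
    | last =>
      have hadj : (G.genMycielskian t).Adj (some (Fin.last t, x)) none := Fin.val_last t
      exact ⟨Walk.cons hadj Walk.nil, rfl⟩
    | cast i ih =>
      obtain ⟨y, hxy⟩ := exists_adj_iff_not_isIsolated.2 (hG x)
      obtain ⟨p, hp⟩ := ih y
      have hadj : (G.genMycielskian t).Adj (some (i.castSucc, x)) (some (i.succ, y)) :=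
        ⟨hxy, Or.inr (Or.inl rfl)⟩
      refine ⟨Walk.cons hadj p, ?_⟩
      change (i : ℕ) + (p.length + 1) = t + 1
      change (i : ℕ) + 1 + p.length = t + 1 at hp
      omega

variable {φ : G.genMycielskian t ≃g G.genMycielskian t}

theorem level_le_level_apply (hG : ∀ x, ¬ G.IsIsolated x) (hφ : φ none = none)
    (v : Option (Fin (t + 1) × V)) : level v ≤ level (φ v) := by
  obtain ⟨p, hp⟩ := exists_walk_none hG v
  have hle := level_le_add_length (p.map φ.toHom)
  rw [Walk.length_map] at hle
  change level (φ none) ≤ level (φ v) + p.length at hle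
  rw [hφ] at hle
  change t + 1 ≤ level (φ v) + p.length at hle
  omega

theorem level_apply (hG : ∀ x, ¬ G.IsIsolated x) (hφ : φ none = none)
    (v : Option (Fin (t + 1) × V)) : level (φ v) = level v := by
  refine le_antisymm ?_ (level_le_level_apply hG hφ v)
  have hφ' : φ.symm none = none := φ.symm_apply_eq.2 hφ.symm
  simpa using level_le_level_apply hG hφ' (φ v)

end Level

section Automorphism

variable {φ : G.genMycielskian t ≃g G.genMycielskian t}

theorem exists_apply_some_eq (hG : ∀ x, ¬ G.IsIsolated x) (hφ : φ none = none)
    (s : Fin (t + 1)) (x : V) : ∃ y, φ (some (s, x)) = some (s, y) := by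
  have hlevel := level_apply hG hφ (some (s, x))
  rcases hv : φ (some (s, x)) with _ | ⟨r, y⟩
  · exact absurd (φ.injective (hv.trans hφ.symm)) (Option.some_ne_none _)
  · rw [hv] at hlevel
    obtain rfl : r = s := Fin.ext hlevel
    exact ⟨y, rfl⟩

theorem exists_perm_of_apply_none (hG : ∀ x, ¬ G.IsIsolated x) (hφ : φ none = none) :
    ∃ f : Fin (t + 1) → Equiv.Perm V, ∀ s x, φ (some (s, x)) = some (s, f s x) := by
  choose f hf using exists_apply_some_eq hG hφ
  choose f' hf' using exists_apply_some_eq hG (φ.symm_apply_eq.2 hφ.symm)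
  have hleft (s : Fin (t + 1)) : LeftInverse (f' s) (f s) := fun x => by
    simpa [hf, hf'] using φ.symm_apply_apply (some (s, x))
  have hright (s : Fin (t + 1)) : RightInverse (f' s) (f s) := fun x => by
    simpa [hf, hf'] using φ.apply_symm_apply (some (s, x))
  exact ⟨fun s => ⟨f s, f' s, hleft s, hright s⟩, hf⟩

variable {f : Fin (t + 1) → Equiv.Perm V}

theorem adj_perm_iff (hf : ∀ s x, φ (some (s, x)) = some (s, f s x)) {s r : Fin (t + 1)}
    (hsr : ((s : ℕ) = 0 ∧ (r : ℕ) = 0) ∨ (r : ℕ) = s + 1 ∨ (s : ℕ) = r + 1) {x y : V} :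
    G.Adj (f s x) (f r y) ↔ G.Adj x y := by
  have := φ.map_adj_iff (v := some (s, x)) (w := some (r, y))
  simpa only [hf, genMycielskian_adj_some, hsr, and_true] using this

theorem neighborSet_perm_eq (hf : ∀ s x, φ (some (s, x)) = some (s, f s x)) (s : Fin (t + 1))
    (x : V) : G.neighborSet (f s x) = G.neighborSet (f 0 x) := by
  induction s using Fin.induction generalizing x with
  | zero => rfl
  | succ i ih =>
    ext z
    obtain ⟨y, rfl⟩ := (f i.castSucc).surjective z
    calc G.Adj (f i.succ x) (f i.castSucc y) ↔ G.Adj x y :=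
          adj_perm_iff hf (Or.inr (Or.inr rfl))
      _ ↔ G.Adj (f 0 y) (f 0 x) := by
          rw [adj_perm_iff hf (Or.inl ⟨rfl, rfl⟩), G.adj_comm]
      _ ↔ G.Adj (f 0 x) (f i.castSucc y) := by
          rw [← adj_congr_of_neighborSet_eq (ih y), G.adj_comm]

theorem apply_none_eq_none (ht : 1 ≤ t) {y : V} (hy : ∀ s, φ (some (s, y)) = some (s, y)) :
    φ none = none := by
  have adj_iff (s : Fin (t + 1)) :
      (G.genMycielskian t).Adj (φ none) (some (s, y)) ↔ (s : ℕ) = t := by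
    conv_lhs => rw [← hy, φ.map_adj_iff]
    exact genMycielskian_adj_none
  rcases hv : φ none with _ | ⟨r, z⟩
  · rfl
  · simp only [hv, genMycielskian_adj_some] at adj_iff
    obtain ⟨hzy, hr⟩ := (adj_iff (Fin.last t)).2 (Fin.val_last t)
    rw [Fin.val_last] at hr
    -- A copy of `z` adjacent to the top copy of `y` lies on level `t - 1`, hence it is also
    -- adjacent to the copy of `y` on level `t - 2`, or on level `0` if `t = 1`; truncation covers
    -- both cases.
    have := (adj_iff ⟨t - 2, by omega⟩).1 ⟨hzy, by simp only; omega⟩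
    simp only at this
    omega

theorem isDetermining_of_levelFiber (ht : 1 ≤ t) (hG : ∀ x, ¬ G.IsIsolated x)
    {S : Finset (Option (Fin (t + 1) × V))} (hzero : G.IsDetermining (levelFiber S 0))
    (hcover : ∀ s, G.IsTwinCover (levelFiber S s)) {y : V} (hy : ∀ s, y ∈ levelFiber S s) :
    (G.genMycielskian t).IsDetermining S := by
  intro φ hφ
  have hnone : φ none = none := apply_none_eq_none ht fun s => hφ _ (mem_levelFiber.1 (hy s))
  obtain ⟨f, hf⟩ := exists_perm_of_apply_none hG hnone
  have hfix (s : Fin (t + 1)) (x : V) (hx : x ∈ levelFiber S s) : f s x = x := by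
    simpa [hf] using hφ _ (mem_levelFiber.1 hx)
  let g : G ≃g G := ⟨f 0, adj_perm_iff hf (Or.inl ⟨rfl, rfl⟩)⟩
  have hg : g = Iso.refl := hzero g (hfix 0)
  have htwin (s : Fin (t + 1)) (x : V) : G.neighborSet (f s x) = G.neighborSet x :=
    (neighborSet_perm_eq hf s x).trans (congrArg G.neighborSet (DFunLike.congr_fun hg x))
  ext (_ | ⟨s, x⟩) : 1
  · exact hnone
  · rw [hf, apply_eq_self_of_isTwinCover (hcover s) (f s).injective (hfix s) (htwin s) x]
    rfl

end Automorphism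

section UpperBound

variable {S T : Finset V}

theorem detNumber_genMycielskian_le_of_isDetermining (ht : 1 ≤ t) (hG : ∀ x, ¬ G.IsIsolated x)
    (hT : G.IsTwinCover T) (hne : T.Nonempty) (hS : G.IsDetermining S) (hTS : T ⊆ S) :
    (G.genMycielskian t).detNumber ≤ S.card + t * T.card := by
  obtain ⟨y, hy⟩ := hne
  let F : Fin (t + 1) → Finset V := Fin.cons S fun _ => T
  have hdet : (G.genMycielskian t).IsDetermining (levelUnion F) := by
    refine isDetermining_of_levelFiber ht hG (y := y) ?_ ?_ ?_ <;>
      simp only [levelFiber_levelUnion]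
    · exact hS
    · exact Fin.cases (isTwinCover_of_isDetermining hS) fun _ => hT
    · exact Fin.cases (hTS hy) fun _ => hy
  calc (G.genMycielskian t).detNumber ≤ (levelUnion F).card := detNumber_le_card hdet
    _ = S.card + t * T.card := by simp [card_levelUnion, Fin.sum_univ_succ, F]

theorem detNumber_genMycielskian_le [Finite V] (ht : 1 ≤ t) (hG : ∀ x, ¬ G.IsIsolated x)
    (hT : G.IsTwinCover T) (hne : T.Nonempty) :
    (G.genMycielskian t).detNumber ≤ (t + 1) * T.card + G.twinQuotient.detNumber := by
  classical
  obtain ⟨D, hD, hcard⟩ := exists_isDetermining_card_eq_detNumber G.twinQuotient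
  let S : Finset V := T ∪ D.image Quotient.out
  have hTS : T ⊆ S := Finset.subset_union_left
  have hS : G.IsDetermining S := isDetermining_of_twinQuotient
    (fun x y h => (hT x y h).imp (@hTS x) (@hTS y)) hD fun d hd =>
      ⟨d.out, Finset.mem_union_right _ (Finset.mem_image_of_mem _ hd), d.out_eq⟩
  have hScard : S.card ≤ T.card + G.twinQuotient.detNumber :=
    (Finset.card_union_le _ _).trans (Nat.add_le_add_left (hcard ▸ Finset.card_image_le) _)
  calc (G.genMycielskian t).detNumber ≤ S.card + t * T.card :=
        detNumber_genMycielskian_le_of_isDetermining ht hG hT hne hS hTS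
    _ ≤ (t + 1) * T.card + G.twinQuotient.detNumber := by linarith

end UpperBound

end Mycielskian

section Path

theorem not_isIsolated_pathGraph (n : ℕ) (i : Fin (n + 2)) : ¬ (pathGraph (n + 2)).IsIsolated i :=
  (pathGraph_preconnected (n + 2)).not_isIsolated i

/-- The reflection of a path. -/
def pathGraphReflection (n : ℕ) : pathGraph n ≃g pathGraph n where
  toEquiv := Fin.revPerm
  map_rel_iff' {i j} := by
    simp only [pathGraph_adj, Fin.revPerm_apply, Fin.val_rev]
    omega

theorem isDetermining_pathGraph (n : ℕ) : (pathGraph (n + 1)).IsDetermining {0} := by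
  intro φ hφ
  suffices hfix : ∀ (k : ℕ) (hk : k < n + 1), φ ⟨k, hk⟩ = ⟨k, hk⟩ from
    RelIso.ext fun i => hfix i i.2
  intro k
  induction k using Nat.strong_induction_on with
  | _ k ih =>
    intro hk
    rcases k with _ | k
    · exact hφ 0 (Finset.mem_singleton_self 0)
    · have hadj : (pathGraph (n + 1)).Adj (φ ⟨k, by omega⟩) (φ ⟨k + 1, hk⟩) :=
        φ.map_adj_iff.2 (pathGraph_adj.2 (Or.inl rfl))
      rw [ih k (by omega), pathGraph_adj] at hadj
      rcases hadj with hup | hdown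
      · exact Fin.ext hup.symm
      · have hback := φ.injective ((ih (k - 1) (by omega) (by omega)).trans
          (Fin.ext (by simp only at hdown ⊢; omega) : _ = φ ⟨k + 1, hk⟩))
        simp only [Fin.mk.injEq] at hback
        omega

theorem detNumber_pathGraph (n : ℕ) : (pathGraph (n + 2)).detNumber = 1 := by
  refine detNumber_eq_one (isDetermining_pathGraph (n + 1)) (φ := pathGraphReflection (n + 2)) ?_
  intro h
  have : Fin.rev (0 : Fin (n + 2)) = 0 := DFunLike.congr_fun h 0
  simp [Fin.ext_iff] at this

theorem injective_neighborSet_pathGraph_two : Injective (pathGraph 2).neighborSet := by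
  intro i j h
  simp only [Set.ext_iff, mem_neighborSet, pathGraph_adj] at h
  revert i j
  decide

theorem injective_neighborSet_pathGraph_five : Injective (pathGraph 5).neighborSet := by
  intro i j h
  simp only [Set.ext_iff, mem_neighborSet, pathGraph_adj] at h
  revert i j
  decide

end Path

section CompleteBipartite

variable {α β : Type*}

/-- The side of a vertex of the complete bipartite graph, as a vertex of the path `P₂`. -/
def bipartiteSide : α ⊕ β → Fin 2 :=
  Sum.elim (fun _ => 0) fun _ => 1

theorem bipartiteSide_surjective [Nonempty α] [Nonempty β] :
    Surjective (bipartiteSide : α ⊕ β → Fin 2) :=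
  Fin.forall_fin_two.2 ⟨⟨.inl (Classical.arbitrary α), rfl⟩, ⟨.inr (Classical.arbitrary β), rfl⟩⟩

theorem completeBipartiteGraph_eq_comap (α β : Type*) :
    completeBipartiteGraph α β = (pathGraph 2).comap bipartiteSide := by
  ext x y
  rcases x with x | x <;> rcases y with y | y <;> simp [bipartiteSide, pathGraph_adj]

theorem not_isIsolated_completeBipartiteGraph [Nonempty α] [Nonempty β] (x : α ⊕ β) :
    ¬ (completeBipartiteGraph α β).IsIsolated x := by
  rw [completeBipartiteGraph_eq_comap]
  exact not_isIsolated_comap bipartiteSide_surjective (not_isIsolated_pathGraph 0) x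

/-- The twin quotient of a complete bipartite graph is the path `P₂`. -/
noncomputable def twinQuotientCompleteBipartiteIso (α β : Type*) [Nonempty α] [Nonempty β] :
    (completeBipartiteGraph α β).twinQuotient ≃g pathGraph 2 :=
  completeBipartiteGraph_eq_comap α β ▸
    twinQuotientComapIso bipartiteSide_surjective injective_neighborSet_pathGraph_two

theorem isTwin_completeBipartiteGraph_inr {b c : β} (h : b ≠ c) :
    (completeBipartiteGraph α β).IsTwin (.inr b) (.inr c) :=
  ⟨Sum.inr_injective.ne h, by ext; simp⟩

theorem isDetermining_completeBipartiteGraph [Nonempty α] [Nonempty β] {T : Finset (α ⊕ β)}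
    (hT : (completeBipartiteGraph α β).IsTwinCover T) (hne : T.Nonempty) :
    (completeBipartiteGraph α β).IsDetermining T := by
  let e := twinQuotientCompleteBipartiteIso α β
  have : Finite (Quotient (completeBipartiteGraph α β).twinSetoid) :=
    Finite.of_equiv _ e.symm.toEquiv
  obtain ⟨y, hy⟩ := hne
  refine isDetermining_of_twinQuotient hT (D := {Quotient.mk _ y}) ?_
    fun d hd => ⟨y, hy, (Finset.mem_singleton.1 hd).symm⟩
  exact isDetermining_of_card_le (by simp [Nat.card_congr e.toEquiv])

theorem detNumber_genMycielskian_completeBipartiteGraph [Nonempty α] [Nonempty β] [Finite α]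
    [Finite β] {t : ℕ} (ht : 1 ≤ t) {T : Finset (α ⊕ β)}
    (hT : (completeBipartiteGraph α β).IsMinTwinCover T) (hne : T.Nonempty) :
    ((completeBipartiteGraph α β).genMycielskian t).detNumber = (t + 1) * T.card := by
  refine le_antisymm ?_ (mul_card_le_detNumber_genMycielskian hT)
  refine (detNumber_genMycielskian_le_of_isDetermining ht not_isIsolated_completeBipartiteGraph
    hT.1 hne (isDetermining_completeBipartiteGraph hT.1 hne) subset_rfl).trans_eq ?_
  ring

end CompleteBipartite

section PendantC4

variable {n : ℕ}

/-- The position of a vertex of `pendantC4 n` on the path `u, v, x, w, z`. -/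
def pendantC4Position : Fin 4 ⊕ Fin n → Fin 5 :=
  Sum.elim ![0, 1, 3, 4] fun _ => 2

theorem pendantC4Position_surjective [NeZero n] :
    Surjective (pendantC4Position : Fin 4 ⊕ Fin n → Fin 5) := by
  intro i
  fin_cases i
  exacts [⟨.inl 0, rfl⟩, ⟨.inl 1, rfl⟩, ⟨.inr 0, rfl⟩, ⟨.inl 2, rfl⟩, ⟨.inl 3, rfl⟩]

theorem pendantC4_eq_comap (n : ℕ) : pendantC4 n = (pathGraph 5).comap pendantC4Position := by
  ext (a | i) (b | j) <;>
    simp only [pendantC4, fromRel_adj, comap_adj, pendantC4Position, pathGraph_adj, Sum.elim_inl,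
      Sum.elim_inr, ne_eq, Sum.inl.injEq, Sum.inr.injEq, reduceCtorEq]
  · revert a b
    decide
  · revert a
    decide
  · revert b
    decide
  · simp

theorem not_isIsolated_pendantC4 [NeZero n] (x : Fin 4 ⊕ Fin n) :
    ¬ (pendantC4 n).IsIsolated x := by
  rw [pendantC4_eq_comap]
  exact not_isIsolated_comap pendantC4Position_surjective (not_isIsolated_pathGraph 3) x

/-- The twin quotient of `pendantC4 n` is the path `P₅`. -/
noncomputable def twinQuotientPendantC4Iso (n : ℕ) [NeZero n] :
    (pendantC4 n).twinQuotient ≃g pathGraph 5 :=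
  pendantC4_eq_comap n ▸
    twinQuotientComapIso pendantC4Position_surjective injective_neighborSet_pathGraph_five

theorem isTwin_pendantC4_iff [NeZero n] {x y : Fin 4 ⊕ Fin n} :
    (pendantC4 n).IsTwin x y ↔ ∃ i j, i ≠ j ∧ x = .inr i ∧ y = .inr j := by
  rw [IsTwin, pendantC4_eq_comap, neighborSet_comap_eq_iff pendantC4Position_surjective
    injective_neighborSet_pathGraph_five]
  rcases x with a | i <;> rcases y with b | j <;>
    simp only [pendantC4Position, Sum.elim_inl, Sum.elim_inr, ne_eq, Sum.inl.injEq, Sum.inr.injEq,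
      reduceCtorEq, not_false_eq_true, true_and, false_and, and_false, and_true, exists_const,
      iff_false]
  · revert a b
    decide
  · revert a
    decide
  · revert b
    decide
  · simp

/-- The reflection of `pendantC4 n` that interchanges `u` with `z` and `v` with `w`. -/
def pendantC4Reflection (n : ℕ) : pendantC4 n ≃g pendantC4 n where
  toEquiv := Equiv.sumCongr Fin.revPerm (Equiv.refl _)
  map_rel_iff' {x y} := by
    have position_apply (x : Fin 4 ⊕ Fin n) :
        pendantC4Position (Equiv.sumCongr Fin.revPerm (Equiv.refl _) x) =
          pathGraphReflection 5 (pendantC4Position x) := by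
      rcases x with a | i
      · fin_cases a <;> rfl
      · rfl
    rw [pendantC4_eq_comap, comap_adj, comap_adj, position_apply, position_apply]
    exact (pathGraphReflection 5).map_adj_iff

theorem pendantC4Reflection_ne_refl : pendantC4Reflection n ≠ Iso.refl := by
  intro h
  have : (Sum.inl 3 : Fin 4 ⊕ Fin n) = .inl 0 := DFunLike.congr_fun h (.inl 0)
  simp at this

theorem detNumber_twinQuotient_pendantC4 [NeZero n] : (pendantC4 n).twinQuotient.detNumber = 1 :=
  (detNumber_congr (twinQuotientPendantC4Iso n)).trans (detNumber_pathGraph 3)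

theorem detNumber_genMycielskian_pendantC4 [NeZero n] {t : ℕ} (ht : 1 ≤ t)
    {T : Finset (Fin 4 ⊕ Fin n)} (hT : (pendantC4 n).IsMinTwinCover T) (hne : T.Nonempty) :
    ((pendantC4 n).genMycielskian t).detNumber =
      (t + 1) * T.card + (pendantC4 n).twinQuotient.detNumber := by
  refine le_antisymm (detNumber_genMycielskian_le ht not_isIsolated_pendantC4 hT.1 hne) ?_
  rw [detNumber_twinQuotient_pendantC4]
  refine mul_card_add_one_le_detNumber_genMycielskian hT pendantC4Reflection_ne_refl
    fun x y hxy => ?_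
  obtain ⟨i, j, -, rfl, rfl⟩ := isTwin_pendantC4_iff.1 hxy
  rfl

end PendantC4

end DeterminingNumber

open DeterminingNumber in
theorem theorem4p6 (t : ℕ) (ht : 1 ≤ t) :
    -- the two bounds
    (∀ (V : Type*) [Finite V] (G : SimpleGraph V) (T : Finset V),
      (∀ x, ¬ G.IsIsolated x) → (∃ x y, G.IsTwin x y) → G.IsMinTwinCover T →
        (t + 1) * T.card ≤ (G.genMycielskian t).detNumber ∧
        (G.genMycielskian t).detNumber ≤ (t + 1) * T.card + G.twinQuotient.detNumber) ∧
    -- the lower bound is sharp: complete bipartite graphs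
    (∀ l m : ℕ, 1 ≤ l → 2 ≤ m →
      (∀ x, ¬ (completeBipartiteGraph (Fin l) (Fin m)).IsIsolated x) ∧
      (∃ x y, (completeBipartiteGraph (Fin l) (Fin m)).IsTwin x y) ∧
      (completeBipartiteGraph (Fin l) (Fin m)).twinQuotient.detNumber = 1 ∧
      ∃ T, (completeBipartiteGraph (Fin l) (Fin m)).IsMinTwinCover T ∧ T.card + 2 = l + m ∧
        ((completeBipartiteGraph (Fin l) (Fin m)).genMycielskian t).detNumber
          = (t + 1) * T.card) ∧
    -- the upper bound is sharp: the 4-cycle with two pendant vertices and its extensions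
    (∀ n : ℕ, 2 ≤ n →
      (∀ x, ¬ (SimpleGraph.pendantC4 n).IsIsolated x) ∧
      (∃ x y, (SimpleGraph.pendantC4 n).IsTwin x y) ∧
      (SimpleGraph.pendantC4 n).twinQuotient.detNumber = 1 ∧
      ∃ T, (SimpleGraph.pendantC4 n).IsMinTwinCover T ∧ T.card + 1 = n ∧
        ((SimpleGraph.pendantC4 n).genMycielskian t).detNumber
          = (t + 1) * T.card + (SimpleGraph.pendantC4 n).twinQuotient.detNumber) := by
  refine ⟨?_, ?_, ?_⟩
  · rintro V _ G T hG ⟨x, y, hxy⟩ hT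
    have hne : T.Nonempty := (hT.1 x y hxy).elim (⟨x, ·⟩) (⟨y, ·⟩)
    exact ⟨mul_card_le_detNumber_genMycielskian hT, detNumber_genMycielskian_le ht hG hT.1 hne⟩
  · intro l m hl hm
    have : NeZero l := ⟨by omega⟩
    have : NeZero m := ⟨by omega⟩
    let e := twinQuotientCompleteBipartiteIso (Fin l) (Fin m)
    obtain ⟨T, hT, hcard⟩ := exists_isMinTwinCover (completeBipartiteGraph (Fin l) (Fin m))
    have hcard : T.card + 2 = l + m := by simpa [Nat.card_congr e.toEquiv] using hcard
    exact ⟨not_isIsolated_completeBipartiteGraph,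
      ⟨_, _, isTwin_completeBipartiteGraph_inr (b := (⟨0, by omega⟩ : Fin m)) (c := ⟨1, by omega⟩)
        (by simp)⟩,
      (detNumber_congr e).trans (detNumber_pathGraph 0), T, hT, hcard,
      detNumber_genMycielskian_completeBipartiteGraph ht hT (Finset.card_pos.1 (by omega))⟩
  · intro n hn
    have : NeZero n := ⟨by omega⟩
    obtain ⟨T, hT, hcard⟩ := exists_isMinTwinCover (SimpleGraph.pendantC4 n)
    have hcard : T.card + 1 = n := by
      simp only [Nat.card_congr (twinQuotientPendantC4Iso n).toEquiv, Nat.card_sum, Nat.card_fin]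
        at hcard
      omega
    exact ⟨not_isIsolated_pendantC4,
      ⟨_, _, isTwin_pendantC4_iff.2 ⟨⟨0, by omega⟩, ⟨1, by omega⟩, by simp, rfl, rfl⟩⟩,
      detNumber_twinQuotient_pendantC4, T, hT, hcard,
      detNumber_genMycielskian_pendantC4 ht hT (Finset.card_pos.1 (by omega))⟩
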